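/- **Setting.** Let $n\ge 2$, let $\mathcal A=\{1,\dots,n\}$ be the set of arms and let $\delta\in(0,1)$. A dueling bandits problem with indifferences $\mathbf P$ assigns to all $i,j\in\mathcal A$ a ternary distribution $P^{(i,j)}=(P_\succ^{(i,j)},P_{\cong}^{(i,j)},P_\prec^{(i,j)})$ with $P_\prec^{(i,j)}=P_\succ^{(j,i)}$; every duel of $i$ and $j$ independently shows $i\succ j$, $i\cong j$ or $i\prec j$ with these probabilities. The Copeland score of $i$ is $$\mathrm{CP}(i)=\sum_{j\ne i}\mathbf 1\{P_\succ^{(i,j)}>\max(P_\prec^{(i,j)},P_{\cong}^{(i,j)})\}+\tfrac12\sum_{j\neq i}\mathbf 1\{P_{\cong}^{(i,j)}>\max(P_\succ^{(i,j)},P_\prec^{(i,j)})\},$$ and a Copeland winner is an arm with maximal Copeland score. Write $p_{(1)}\ge p_{(2)}\ge p_{(3)}$ for the order statistics of $p_1,p_2,p_3$. **PPR-1v1**$(i,j,\delta')$: duel $i$ and $j$ repeatedly and count the outcomes $i\succ j$, $i\cong j$, $i\prec j$ by $S_1,S_2,S_3$. After each duel, stop if $f_{\mathrm{Beta}}(1/2;S_{(1)}+1,S_{(2)}+1)\le\delta'/2$,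 where $f_{\mathrm{Beta}}(\cdot\,;\alpha,\beta)$ is the density of the Beta distribution, and return $\operatorname{argmax}_k S_k$. **POCOWISTA**$(\mathcal A,\delta)$: start with $D(i)=\{i\}$, $\widehat{CP}(i)=0$, and let $\overline{CP}(i)=n-|D(i)|+\widehat{CP}(i)$ throughout. While there is no arm $i$ with $\widehat{CP}(i)\ge\overline{CP}(j)$ for all $j\ne i$, choose $i_t\in\operatorname{argmax}_{i}\overline{CP}(i)$ and $j_t\in\operatorname{argmax}_{j\notin D(i_t)}\widehat{CP}(j)$, run PPR-1v1$(i_t,j_t,\delta/\binom n2)$ to get $k$, add $1$ to $\widehat{CP}(i_t)$ if $k=1$, add $\frac12$ to both $\widehat{CP}(i_t)$ and $\widehat{CP}(j_t)$ if $k=2$, add $1$ to $\widehat{CP}(j_t)$ if $k=3$, and put $j_t$ into $D(i_t)$ and $i_t$ into $D(j_t)$. When the loop ends, return an arm $i$ with $\widehat{CP}(i)\ge\overline{CP}(j)$ for all $j\neq i$ (such an arm maximizes $\widehat{CP}$). All remaining choices among admissible arms are made by an arbitrary, possibly random, rule. **Theorem.** Assume that $P^{(i,j)}$ has a unique mode for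 all $i\ne j$, that is, $P^{(i,j)}_{(1)}>P^{(i,j)}_{(2)}$. Then, with probability at least $1-\delta$, POCOWISTA terminates, returns a Copeland winner and uses at most $$\sum_{i<j}t_0\Big(P^{(i,j)},\delta/\tbinom n2\Big)$$ duels (samples), where $$t_0\big((p_1,p_2,p_3),\delta'\big)=\frac{c_1\,p_{(1)}}{(p_{(1)}-p_{(2)})^{2}}\,\ln\!\Big(\sqrt{\frac{2c_2}{\delta'}}\cdot\frac{p_{(1)}}{p_{(1)}-p_{(2)}}\Big),\qquad c_1=194.07,\ c_2=79.86 .$$ -/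

import Mathlib

open MeasureTheory ProbabilityTheory

noncomputable section

namespace Pocowista

/-- Feedback of a duel of `i` against `j`: `win` is `i ≻ j`, `indiff` is `i ≅ j`,
`loss` is `i ≺ j`. -/
inductive Outcome where
  | win
  | indiff
  | loss
  deriving DecidableEq

instance : MeasurableSpace Outcome := ⊤

/-- The same feedback, read from the side of the other arm. -/
def Outcome.swap : Outcome → Outcome
  | .win => .loss
  | .indiff => .indiff
  | .loss => .win

/-! ### Order statistics of three values -/

/-- The largest of the three values. -/
def largest {α : Type*} [LinearOrder α] (v : Outcome → α) : α :=
  max (v .win) (max (v .indiff) (v .loss))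

/-- The second largest (that is, the median) of the three values. -/
def secondLargest {α : Type*} [LinearOrder α] (v : Outcome → α) : α :=
  max (min (v .win) (v .indiff)) (max (min (v .win) (v .loss)) (min (v .indiff) (v .loss)))

/-! ### Dueling bandits problems with indifferences -/

/-- A dueling bandits problem with indifferences on the arms `Fin n`, given by its matrix of
strict preference probabilities. -/
structure Bandit (n : ℕ) where
  /-- `pSucc i j` is the probability of observing `i ≻ j`. -/
  pSucc : Fin n → Fin n → ℝ
  nonneg : ∀ i j, 0 ≤ pSucc i j
  add_le_one : ∀ i j, pSucc i j + pSucc j i ≤ 1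

namespace Bandit

variable {n : ℕ}

/-- The ternary distribution of the feedback of a duel of `i` against `j`. -/
def prob (P : Bandit n) (i j : Fin n) : Outcome → ℝ
  | .win => P.pSucc i j
  | .indiff => 1 - P.pSucc i j - P.pSucc j i
  | .loss => P.pSucc j i

open Classical in
/-- The Copeland score: one point for every dominated arm, half a point for every indifferent
arm. -/
def copelandScore (P : Bandit n) (i : Fin n) : ℚ :=
  (∑ j ∈ Finset.univ.erase i,
      if P.prob i j .win > max (P.prob i j .loss) (P.prob i j .indiff) then (1 : ℚ) else 0) +
  1 / 2 * ∑ j ∈ Finset.univ.erase i,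
      if P.prob i j .indiff > max (P.prob i j .win) (P.prob i j .loss) then (1 : ℚ) else 0

/-- The Copeland set, i.e. the set of Copeland winners. -/
def copelandSet (P : Bandit n) : Set (Fin n) :=
  {i | ∀ j, P.copelandScore j ≤ P.copelandScore i}

end Bandit

/-! ### The subroutine PPR-1v1 -/

/-- Number of occurrences of `o` among the first `t` entries of the feedback sequence `x`. -/
def count (x : ℕ → Outcome) (t : ℕ) (o : Outcome) : ℕ :=
  ((Finset.range t).filter fun m => x m = o).card

/-- The stopping test of PPR-1v1 after `t` samples:
`f_Beta(1/2; S_(1) + 1, S_(2) + 1) ≤ δ / 2`. -/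
def PPRTest (δ : ℝ) (x : ℕ → Outcome) (t : ℕ) : Prop :=
  betaPDFReal ((largest (count x t) : ℕ) + 1) ((secondLargest (count x t) : ℕ) + 1) (1 / 2)
    ≤ δ / 2

/-- PPR-1v1 with error probability `δ`, run on the feedback sequence `x`, stops after exactly
`t` samples and returns `k`. If the test is never passed, this holds for no `t` and `k`. -/
def PPRReturns (δ : ℝ) (x : ℕ → Outcome) (t : ℕ) (k : Outcome) : Prop :=
  1 ≤ t ∧ PPRTest δ x t ∧ (∀ u, 1 ≤ u → u < t → ¬ PPRTest δ x u) ∧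
    ∀ o, count x t o ≤ count x t k

/-! ### The algorithm POCOWISTA -/

/-- The variables of POCOWISTA. -/
@[ext]
structure State (n : ℕ) where
  /-- `D i`: the arms already compared to `i`, and `i` itself. -/
  D : Fin n → Finset (Fin n)
  /-- The current Copeland scores. -/
  cur : Fin n → ℚ

namespace State

variable {n : ℕ}

/-- The initial state. -/
def init (n : ℕ) : State n where
  D i := {i}
  cur _ := 0

/-- The potential Copeland score `n - |D(i)| + cur(i)`; it is `n - 1` initially. -/
def pot (s : State n) (i : Fin n) : ℚ := (n : ℚ) - ((s.D i).card : ℚ) + s.cur i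

/-- The arm `i` fulfils the termination criterion: its current score is not smaller than the
potential score of any other arm. -/
def Stops (s : State n) (i : Fin n) : Prop := ∀ j, j ≠ i → s.pot j ≤ s.cur i

theorem cur_le_pot (s : State n) (i : Fin n) : s.cur i ≤ s.pot i := by
  have h : (s.D i).card ≤ n := by simpa using Finset.card_le_univ (s.D i)
  have h' : ((s.D i).card : ℚ) ≤ (n : ℚ) := by exact_mod_cast h
  unfold pot
  linarith

/-- An arm that fulfils the termination criterion maximizes the current score. -/
theorem Stops.cur_le {s : State n} {i : Fin n} (h : s.Stops i) (j : Fin n) :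
    s.cur j ≤ s.cur i := by
  by_cases hj : j = i
  · rw [hj]
  · exact (s.cur_le_pot j).trans (h j hj)

/-- The score update after the duel of `i` and `j` was decided as `k`. -/
def update (s : State n) (i j : Fin n) (k : Outcome) : State n where
  D a := if a = i then insert j (s.D i) else if a = j then insert i (s.D j) else s.D a
  cur a := match k with
    | .win => if a = i then s.cur a + 1 else s.cur a
    | .indiff => if a = i ∨ a = j then s.cur a + 1 / 2 else s.cur a
    | .loss => if a = j then s.cur a + 1 else s.cur a

end State

/-- A way to resolve every choice among several admissible arms in POCOWISTA. -/
structure TieBreak (n : ℕ) where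
  /-- The first arm of a round: a maximizer of the potential score. -/
  first : State n → Fin n
  first_max : ∀ (s : State n) (j : Fin n), s.pot j ≤ s.pot (first s)
  /-- The second arm of a round: a maximizer of the current score among the arms that are not
  yet compared to the first arm `i`. -/
  second : State n → Fin n → Fin n
  second_notMem : ∀ (s : State n) (i : Fin n), (∃ j, j ∉ s.D i) → second s i ∉ s.D i
  second_max : ∀ (s : State n) (i j : Fin n), j ∉ s.D i → s.cur j ≤ s.cur (second s i)
  /-- The returned arm: an arm that fulfils the termination criterion (and hence maximizes the
  current score). -/
  winner : State n → Fin n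
  winner_stops : ∀ s : State n, (∃ i, s.Stops i) → s.Stops (winner s)

/-- `Run tb δ' x s τ r`: the main loop of POCOWISTA, entered in state `s`, terminates after
taking `τ` further samples and returns the arm `r`. Here `δ'` is the error probability handed
to PPR-1v1, and `x i j` is the sequence of feedback of the successive duels of `i` against
`j`. -/
inductive Run {n : ℕ} (tb : TieBreak n) (δ' : ℝ) (x : Fin n → Fin n → ℕ → Outcome) :
    State n → ℕ → Fin n → Prop
  | halt (s : State n) (h : ∃ i, s.Stops i) : Run tb δ' x s 0 (tb.winner s)
  | round (s : State n) (h : ¬ ∃ i, s.Stops i) (i j : Fin n) (hi : i = tb.first s)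
      (hj : j = tb.second s i) (t : ℕ) (k : Outcome) (hk : PPRReturns δ' (x i j) t k)
      (τ : ℕ) (r : Fin n) (hrun : Run tb δ' x (s.update i j k) τ r) :
      Run tb δ' x s (t + τ) r

/-- POCOWISTA with error probability `δ` terminates after exactly `τ` samples and
returns `r`. -/
def Returns {n : ℕ} (tb : TieBreak n) (δ : ℝ) (x : Fin n → Fin n → ℕ → Outcome)
    (τ : ℕ) (r : Fin n) : Prop :=
  Run tb (δ / (n.choose 2 : ℝ)) x (State.init n) τ r

/-! ### The random feedback -/

/-- `X i j m` is the feedback of the `m`-th duel of `i` against `j`. It is distributed according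
to the ternary distribution of the pair, the feedback of all duels of all (unordered) pairs is
independent, and a duel of `j` against `i` is a duel of `i` against `j` read from the
other side. -/
structure IsFeedback {n : ℕ} (P : Bandit n) {Ω : Type*} [MeasurableSpace Ω] (μ : Measure Ω)
    (X : Fin n → Fin n → ℕ → Ω → Outcome) : Prop where
  measurable : ∀ i j m, Measurable (X i j m)
  swap : ∀ i j m ω, i ≠ j → X j i m ω = (X i j m ω).swap
  law : ∀ i j m o, i ≠ j → μ {ω | X i j m ω = o} = ENNReal.ofReal (P.prob i j o)
  indep : iIndepFun
    (fun (q : {p : Fin n × Fin n // p.1 < p.2} × ℕ) => X q.1.1.1 q.1.1.2 q.2) μ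

/-! ### The sample complexity bound -/

/-- The bound `t₀(p, δ)` for a ternary distribution `p`. -/
def t₀ (p : Outcome → ℝ) (δ : ℝ) : ℝ :=
  194.07 * largest p *
    Real.log (Real.sqrt (2 * 79.86 / δ) * (largest p / (largest p - secondLargest p))) /
    (largest p - secondLargest p) ^ 2

end Pocowista

end

open Pocowista

namespace Pocowista

open scoped ENNReal Nat

/-! The argument is pathwise outside an event of probability at most `δ`. For a pair with mode `m`
and another outcome `o`, replace the odds of `m` against `o` by a uniform prior. The resulting
mixture is again a probability on words, so by Ville's inequality (`measure_exists_cylinder_le`) the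
true likelihood ever drops to `ε` times the mixture likelihood with probability at most `ε`. The
ratio of true to mixture likelihood is a Beta density at the true odds, which gives `Typical`. Two
choices of `o` at level `δ' / 2` and `n.choose 2` pairs at level `δ'` add up to `δ`.

On a typical sequence PPR-1v1 is correct: had a wrong outcome `k` led when the test passed, the
density at `1 / 2` would be at most `δ' / 2`, and the density at the true odds, which favour the
trailing `m`, would be smaller still (`eq_mode_of_pprTest`). It is also fast: while the test fails,
the counts of `m` and its strongest rival are plausible both under the true odds and under a fair
coin, and the Hellinger distance between the two limits how long this can last
(`pprTest_of_typical`).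

If every duel reveals its mode, the true Copeland score stays between current and potential score,
so the stopping rule certifies a winner. Each pair is dueled at most once, so the budgets `t₀` sum
over pairs (`State.Consistent.exists_run`). This holds for every tie-breaking rule, which may
therefore depend on `ω`. -/

instance : Fintype Outcome := ⟨{.win, .indiff, .loss}, by rintro (_ | _ | _) <;> simp⟩

theorem Outcome.sum_univ {M : Type*} [AddCommMonoid M] (f : Outcome → M) :
    ∑ o, f o = f .win + (f .indiff + f .loss) := by
  change ∑ o ∈ {Outcome.win, .indiff, .loss}, f o = _
  rw [Finset.sum_insert (by simp), Finset.sum_pair (by simp)]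

/-! ### A maximal inequality for cylinder probabilities -/

/-- A form of Ville's inequality: if `Q` is a sub-probability on the tree of finite words, scaled
to mass `Q 0 w₀` at the root, then the random word `X` has a prefix that is no more likely than
`Q` makes it with probability at most `Q 0 w₀`. -/
theorem measure_exists_cylinder_le {O Ω : Type*} [Fintype O] [MeasurableSpace Ω]
    (μ : Measure Ω) (X : ℕ → Ω → O) (Q : ℕ → (ℕ → O) → ℝ≥0∞)
    (hcongr : ∀ t w w', (∀ m < t, w m = w' m) → Q t w = Q t w')
    (hsum : ∀ t w, ∑ o, Q (t + 1) (Function.update w t o) ≤ Q t w) (w₀ : ℕ → O) :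
    μ {ω | ∃ t, μ {ω' | ∀ m < t, X m ω' = X m ω} ≤ Q t (fun m => X m ω)} ≤ Q 0 w₀ := by
  set bad : ℕ → Ω → Prop :=
    fun t ω => μ {ω' | ∀ m < t, X m ω' = X m ω} ≤ Q t (fun m => X m ω) with hbad
  -- Induction on the horizon `T`: either the word `w` is already bad and its whole cylinder is
  -- cheap, or the badness comes later and the event splits over the next letter.
  have key : ∀ T t w, μ {ω | (∀ m < t, X m ω = w m) ∧ ∃ u ≤ T, bad (t + u) ω} ≤ Q t w := by
    intro T
    induction T with
    | zero =>
      intro t w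
      by_cases hb : μ {ω' | ∀ m < t, X m ω' = w m} ≤ Q t w
      · exact (measure_mono fun ω hω => hω.1).trans hb
      · refine le_of_eq_of_le ?_ (zero_le (a := Q t w))
        refine (congrArg μ ?_).trans measure_empty
        rw [Set.eq_empty_iff_forall_notMem]
        rintro ω ⟨hω, u, hu, hbu⟩
        obtain rfl : u = 0 := by omega
        apply hb
        have h2 : {ω' | ∀ m < t, X m ω' = w m} = {ω' | ∀ m < t, X m ω' = X m ω} := by
          ext ω'
          exact forall₂_congr fun m hm => by rw [hω m hm]
        rw [h2, ← hcongr t _ _ hω]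
        exact hbu
    | succ T ih =>
      intro t w
      by_cases hb : μ {ω' | ∀ m < t, X m ω' = w m} ≤ Q t w
      · exact (measure_mono fun ω hω => hω.1).trans hb
      · refine le_trans ?_ (hsum t w)
        refine le_trans ?_ (Finset.sum_le_sum fun o _ => ih (t + 1) (Function.update w t o))
        refine le_trans (measure_mono ?_) (measure_iUnion_fintype_le μ _)
        rintro ω ⟨hω, u, hu, hbu⟩
        rw [Set.mem_iUnion]
        refine ⟨X t ω, fun m hm => ?_, ?_⟩
        · rcases Nat.lt_succ_iff_lt_or_eq.1 hm with h | rfl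
          · rw [Function.update_of_ne h.ne, hω m h]
          · simp
        · rcases u with _ | u
          · exfalso
            apply hb
            have h2 : {ω' | ∀ m < t, X m ω' = w m} = {ω' | ∀ m < t, X m ω' = X m ω} := by
              ext ω'
              exact forall₂_congr fun m hm => by rw [hω m hm]
            rw [h2, ← hcongr t _ _ hω]
            exact hbu
          · exact ⟨u, by omega, by rwa [show t + 1 + u = t + (u + 1) by ring]⟩
  have hU : {ω | ∃ t, bad t ω} = ⋃ T : ℕ, {ω | ∃ u ≤ T, bad u ω} := by
    ext ω
    simp only [Set.mem_ofPred_eq, Set.mem_iUnion]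
    exact ⟨fun ⟨t, h⟩ => ⟨t, t, le_rfl, h⟩, fun ⟨_, t, _, h⟩ => ⟨t, h⟩⟩
  change μ {ω | ∃ t, bad t ω} ≤ _
  -- Continuity from below along the horizons; no measurability of the events is needed.
  rw [hU, Monotone.measure_iUnion]
  · refine iSup_le fun T => ?_
    simpa using key T 0 w₀
  · rintro T T' hT ω ⟨u, hu, h⟩
    exact ⟨u, hu.trans hT, h⟩

/-! ### Counts -/

theorem count_succ (x : ℕ → Outcome) (t : ℕ) (o : Outcome) :
    count x (t + 1) o = count x t o + if x t = o then 1 else 0 := by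
  unfold count
  rw [Finset.range_add_one, Finset.filter_insert]
  split_ifs <;> simp

theorem count_congr {x y : ℕ → Outcome} {t : ℕ} (h : ∀ m < t, x m = y m) (o : Outcome) :
    count x t o = count y t o := by
  unfold count
  congr 1
  exact Finset.filter_congr fun m hm => by rw [h m (Finset.mem_range.1 hm)]

theorem count_zero (x : ℕ → Outcome) (o : Outcome) : count x 0 o = 0 := by
  simp [count]

theorem sum_count (x : ℕ → Outcome) (t : ℕ) : ∑ o, count x t o = t := by
  induction t with
  | zero => simp [count_zero]
  | succ t ih => simp [count_succ, Finset.sum_add_distrib, ih]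

/-! ### The normalization of the Beta density -/

/-- `(a + b + 1)! / (a! b!)`, the inverse of the Beta function at `(a + 1, b + 1)`. -/
noncomputable def betaNorm (a b : ℕ) : ℝ := ((a + b + 1)! : ℝ) / (a ! * b !)

theorem betaNorm_pos (a b : ℕ) : 0 < betaNorm a b := by
  unfold betaNorm
  positivity

theorem betaNorm_succ_left (a b : ℕ) :
    betaNorm (a + 1) b = betaNorm a b * ((a + b + 2) / (a + 1)) := by
  unfold betaNorm
  rw [show a + 1 + b + 1 = (a + b + 1) + 1 by ring, Nat.factorial_succ (a + b + 1),
    Nat.factorial_succ a]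
  push_cast
  field_simp
  ring

theorem betaNorm_comm (a b : ℕ) : betaNorm a b = betaNorm b a := by
  unfold betaNorm
  rw [add_comm a b, mul_comm]

theorem betaNorm_succ_right (a b : ℕ) :
    betaNorm a (b + 1) = betaNorm a b * ((a + b + 2) / (b + 1)) := by
  rw [betaNorm_comm, betaNorm_succ_left, betaNorm_comm, add_comm (b : ℝ)]

/-- Integrate `θ + (1 - θ) = 1` against `θ ^ a * (1 - θ) ^ b`. This is what makes the mixture
likelihood consistent under one more sample. -/
theorem inv_betaNorm_succ_add (a b : ℕ) :
    (betaNorm (a + 1) b)⁻¹ + (betaNorm a (b + 1))⁻¹ = (betaNorm a b)⁻¹ := by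
  rw [betaNorm_succ_left, betaNorm_succ_right]
  have := (betaNorm_pos a b).ne'
  field_simp
  ring

theorem betaNorm_eq_choose (a b : ℕ) :
    betaNorm a b = (a + b + 1) * ((a + b).choose a : ℝ) := by
  have h : (((a + b).choose a * a ! * b ! : ℕ) : ℝ) = ((a + b)! : ℝ) := by
    rw [Nat.choose_symm_add, Nat.add_choose_mul_factorial_mul_factorial]
  unfold betaNorm
  rw [Nat.factorial_succ]
  push_cast at h ⊢
  rw [← h]
  field_simp

theorem betaPDFReal_half (a b : ℕ) :
    betaPDFReal ((a : ℝ) + 1) ((b : ℝ) + 1) (1 / 2) = betaNorm a b * (1 / 2) ^ (a + b) := by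
  unfold betaPDFReal beta betaNorm
  rw [if_pos (by norm_num), Real.Gamma_nat_eq_factorial, Real.Gamma_nat_eq_factorial,
    show (a : ℝ) + 1 + (b + 1) = ((a + b + 1 : ℕ) : ℝ) + 1 by push_cast; ring,
    Real.Gamma_nat_eq_factorial, add_sub_cancel_right, add_sub_cancel_right,
    Real.rpow_natCast, Real.rpow_natCast, pow_add]
  norm_num
  ring

/-! ### The prior-posterior-ratio confidence sequence -/

/-- The feedback sequence `x` never leaves the confidence sequence at level `ε` for the odds of
`m` against `o` under the distribution `p`: the Beta density fitted to the counts of `m` and `o`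
exceeds `ε` at `p m / (p m + p o)` at all times. -/
def Typical (p : Outcome → ℝ) (ε : ℝ) (m o : Outcome) (x : ℕ → Outcome) : Prop :=
  ∀ t, ε * (p m + p o) ^ (count x t m + count x t o) <
    betaNorm (count x t m) (count x t o) * (p m ^ count x t m * p o ^ count x t o)

/-- The distribution `p` with the masses of `m` and `o` both replaced by their sum. -/
noncomputable def pooled (p : Outcome → ℝ) (m o : Outcome) (k : Outcome) : ℝ :=
  if k = m ∨ k = o then p m + p o else p k

/-- `K` is the likelihood of the letters other than `m` and `o`. It is common to both products, so
comparing them involves only the two counts. -/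
theorem prod_eq_mul_prod_pooled (p : Outcome → ℝ) (hp : ∀ o, 0 ≤ p o) {m o : Outcome}
    (hmo : o ≠ m) (x : ℕ → Outcome) (t : ℕ) :
    ∃ K : ℝ, 0 ≤ K ∧
      ∏ i ∈ Finset.range t, p (x i) = K * (p m ^ count x t m * p o ^ count x t o) ∧
      ∏ i ∈ Finset.range t, pooled p m o (x i) =
        K * (p m + p o) ^ (count x t m + count x t o) := by
  induction t with
  | zero => exact ⟨1, by simp [count_zero]⟩
  | succ t ih =>
    obtain ⟨K, hK, h1, h2⟩ := ih
    simp only [Finset.prod_range_succ, h1, h2, count_succ]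
    by_cases hm : x t = m
    · refine ⟨K, hK, ?_, ?_⟩ <;> simp [hm, hmo.symm, pooled] <;> ring
    · by_cases ho : x t = o
      · refine ⟨K, hK, ?_, ?_⟩ <;> simp [ho, hmo, pooled] <;> ring
      · refine ⟨K * p (x t), mul_nonneg hK (hp _), ?_, ?_⟩ <;> simp [hm, ho, pooled] <;> ring

theorem measure_not_typical_le {Ω : Type*} [MeasurableSpace Ω] (μ : Measure Ω)
    (X : ℕ → Ω → Outcome) (p : Outcome → ℝ) (hp : ∀ o, 0 ≤ p o) (hp1 : ∑ o, p o = 1)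
    (hX : ∀ (t : ℕ) (w : ℕ → Outcome), μ {ω | ∀ m < t, X m ω = w m} =
      ENNReal.ofReal (∏ i ∈ Finset.range t, p (w i)))
    {ε : ℝ} (hε : 0 ≤ ε) {m o : Outcome} (hmo : o ≠ m) :
    μ {ω | ¬ Typical p ε m o (fun t => X t ω)} ≤ ENNReal.ofReal ε := by
  have hr : ∀ k, 0 ≤ pooled p m o k := fun k => by
    unfold pooled
    split_ifs
    exacts [add_nonneg (hp _) (hp _), hp _]
  -- `Q` is `ε` times the likelihood of the word when `p m + p o` is split between `m` and `o` in
  -- proportion `θ : 1 - θ`, with `θ` uniform on `[0, 1]`.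
  set Q : ℕ → (ℕ → Outcome) → ℝ := fun t w =>
    ε * (betaNorm (count w t m) (count w t o))⁻¹ * ∏ i ∈ Finset.range t, pooled p m o (w i)
    with hQ
  have hQ0 : ∀ t w, 0 ≤ Q t w := fun t w => mul_nonneg
    (mul_nonneg hε (inv_nonneg.2 (betaNorm_pos _ _).le)) (Finset.prod_nonneg fun i _ => hr _)
  have hcongr : ∀ t w w', (∀ m < t, w m = w' m) → Q t w = Q t w' := by
    intro t w w' h
    simp only [hQ]
    rw [count_congr h, count_congr h,
      Finset.prod_congr rfl fun i hi => by rw [h i (Finset.mem_range.1 hi)]]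
  have hsum : ∀ t w, ∑ k, Q (t + 1) (Function.update w t k) = Q t w := by
    intro t w
    have hc : ∀ k o', count (Function.update w t k) (t + 1) o' =
        count w t o' + if k = o' then 1 else 0 := by
      intro k o'
      rw [count_succ, Function.update_self,
        count_congr (y := w) fun i hi => Function.update_of_ne hi.ne _ _]
    have hprod : ∀ k, ∏ i ∈ Finset.range (t + 1), pooled p m o (Function.update w t k i) =
        (∏ i ∈ Finset.range t, pooled p m o (w i)) * pooled p m o k := by
      intro k
      rw [Finset.prod_range_succ, Function.update_self]
      congr 1
      exact Finset.prod_congr rfl fun i hi => by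
        rw [Function.update_of_ne (Finset.mem_range.1 hi).ne]
    simp only [hQ, hc, hprod]
    have h1 := inv_betaNorm_succ_add (count w t m) (count w t o)
    rw [Outcome.sum_univ] at hp1 ⊢
    generalize ∏ i ∈ Finset.range t, pooled p m o (w i) = R
    -- The letters `m` and `o` together carry mass `p m + p o` by `h1`, the third carries its own
    -- `p`, and the masses add up to `1`.
    cases m <;> cases o <;> simp [pooled] at hmo ⊢ <;>
      rw [← h1] <;> linear_combination (ε * R *
        ((betaNorm (count w t _ + 1) (count w t _))⁻¹ +
          (betaNorm (count w t _) (count w t _ + 1))⁻¹)) * hp1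
  have main := measure_exists_cylinder_le μ X (fun t w => ENNReal.ofReal (Q t w))
    (fun t w w' h => by simp only [hcongr t w w' h])
    (fun t w => by
      rw [← ENNReal.ofReal_sum_of_nonneg fun k _ => hQ0 _ _, hsum]) (fun _ => .win)
  refine (measure_mono ?_).trans (main.trans ?_)
  · intro ω hω
    simp only [Typical, Set.mem_ofPred_eq, not_forall, not_lt] at hω
    obtain ⟨t, ht⟩ := hω
    refine ⟨t, ?_⟩
    rw [hX t fun m => X m ω]
    refine ENNReal.ofReal_le_ofReal ?_
    obtain ⟨K, hK, h1, h2⟩ := prod_eq_mul_prod_pooled p hp hmo (fun m => X m ω) t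
    simp only [hQ]
    rw [h1, h2]
    have hD := betaNorm_pos (count (fun m => X m ω) t m) (count (fun m => X m ω) t o)
    rw [show ∀ e d k s : ℝ, e * d⁻¹ * (k * s) = k * (e * s) / d by intros; ring,
      le_div_iff₀ hD]
    calc _ = K * (betaNorm (count (fun m => X m ω) t m) (count (fun m => X m ω) t o) *
          (p m ^ count (fun m => X m ω) t m * p o ^ count (fun m => X m ω) t o)) := by ring
      _ ≤ _ := mul_le_mul_of_nonneg_left ht hK
  · simp [hQ, count_zero, betaNorm]

/-! ### Bounds on the Beta density -/

/-- Consecutive values have ratio `(a + b + 2) / (2 * (b + 1))`, which is at least `1` as long as `b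
≤ a`. -/
theorem betaNorm_half_mono {a b' b : ℕ} (hb : b' ≤ b) (hba : b ≤ a) :
    betaNorm a b' * (1 / 2) ^ (a + b') ≤ betaNorm a b * (1 / 2) ^ (a + b) := by
  induction b, hb using Nat.le_induction with
  | base => rfl
  | succ b hb ih =>
    refine (ih (by omega)).trans ?_
    rw [betaNorm_succ_right, ← add_assoc, pow_succ,
      show ∀ d r s : ℝ, d * r * (s * (1 / 2)) = d * s * (r * (1 / 2)) by intros; ring]
    refine le_mul_of_one_le_right (mul_nonneg (betaNorm_pos _ _).le (by positivity)) ?_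
    have : (b : ℝ) + 1 ≤ a := by exact_mod_cast hba
    rw [div_mul_div_comm, mul_one, le_div_iff₀ (by positivity)]
    linarith

/-- Pair each `q` with an `r` by AM-GM; the unpaired factors are all `r`, which is below the mean.
-/
theorem pow_mul_pow_le_of_le {q r : ℝ} (hr : 0 ≤ r) (hrq : r ≤ q) {a b : ℕ} (hab : a ≤ b) :
    q ^ a * r ^ b ≤ ((q + r) / 2) ^ (a + b) := by
  obtain ⟨c, rfl⟩ := Nat.exists_eq_add_of_le hab
  have h1 : q * r ≤ ((q + r) / 2) ^ 2 := by nlinarith [sq_nonneg (q - r)]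
  calc q ^ a * r ^ (a + c) = (q * r) ^ a * r ^ c := by rw [pow_add, mul_pow]; ring
    _ ≤ (((q + r) / 2) ^ 2) ^ a * ((q + r) / 2) ^ c := by
        gcongr
        · exact mul_nonneg (hr.trans hrq) hr
        · linarith
    _ = _ := by rw [← pow_mul, ← pow_add]; congr 1; ring

/-- The Hellinger bound: a sample for which the binomial likelihoods at `q` and at `1 / 2` are
both large is unlikely. -/
theorem choose_sq_mul_le {q r : ℝ} (hq : 0 ≤ q) (hr : 0 ≤ r) (hqr : q + r = 1) (a b : ℕ) :
    ((a + b).choose a : ℝ) ^ 2 * ((1 / 2) ^ (a + b) * (q ^ a * r ^ b)) ≤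
      Real.exp (-((a + b) * (q - r) ^ 2 / 4)) := by
  set s := Real.sqrt (q / 2)
  set u := Real.sqrt (r / 2)
  have hs : s ^ 2 = q / 2 := Real.sq_sqrt (by positivity)
  have hu : u ^ 2 = r / 2 := Real.sq_sqrt (by positivity)
  have hs0 : 0 ≤ s := Real.sqrt_nonneg _
  have hu0 : 0 ≤ u := Real.sqrt_nonneg _
  -- `s + u` is the Bhattacharyya coefficient of `(q, r)` and the fair coin; the left side is a
  -- single term of its binomial expansion.
  have h1 : ((a + b).choose a : ℝ) * (s ^ a * u ^ b) ≤ (s + u) ^ (a + b) := by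
    rw [add_pow]
    refine le_trans (le_of_eq ?_) (Finset.single_le_sum
      (f := fun m => s ^ m * u ^ (a + b - m) * ((a + b).choose m : ℝ)) (s := Finset.range (a + b + 1))
      (fun m _ => by positivity) (Finset.mem_range.2 (by omega : a < a + b + 1)))
    simp only [Nat.add_sub_cancel_left]
    ring
  have h2 : (s + u) ^ 2 ≤ Real.exp (-((q - r) ^ 2 / 4)) := by
    refine le_trans ?_ (Real.add_one_le_exp _)
    have h3 : 2 * (s * u) ≤ 1 / 2 - (q - r) ^ 2 / 4 := by
      refine le_of_pow_le_pow_left₀ two_ne_zero ?_ ?_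
      · nlinarith
      · have h4 : (2 * (s * u)) ^ 2 = q * r := by
          rw [mul_pow, mul_pow, hs, hu]; ring
        rw [h4]
        obtain rfl : r = 1 - q := by linarith
        nlinarith [sq_nonneg ((q - (1 - q)) ^ 2)]
    nlinarith
  calc _ = (((a + b).choose a : ℝ) * (s ^ a * u ^ b)) ^ 2 := by
        rw [mul_pow, mul_pow, ← pow_mul, ← pow_mul, mul_comm a, mul_comm b, pow_mul, pow_mul, hs,
          hu, div_pow, div_pow, div_pow, one_pow, pow_add]
        field_simp
    _ ≤ ((s + u) ^ (a + b)) ^ 2 := by gcongr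
    _ = ((s + u) ^ 2) ^ (a + b) := by rw [← pow_mul, ← pow_mul, mul_comm]
    _ ≤ Real.exp (-((q - r) ^ 2 / 4)) ^ (a + b) := by gcongr
    _ = _ := by
        rw [← Real.exp_nat_mul]
        congr 1
        push_cast
        ring

/-- If the Beta density fitted to the counts `a`, `b` exceeds `ε` at `q` and, unless `a ≤ b`,
also at `1 / 2`, then the number of samples is bounded. -/
theorem lt_mul_exp_of_not_rejected {q r ε : ℝ} (hr : 0 ≤ r) (hrq : r ≤ q)
    (hqr : q + r = 1) (hε : 0 < ε) {a b : ℕ}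
    (h1 : ε < betaNorm a b * (q ^ a * r ^ b))
    (h2 : b ≤ a → ε < betaNorm a b * (1 / 2) ^ (a + b)) :
    ε < (a + b + 1) * Real.exp (-((a + b) * (q - r) ^ 2 / 8)) := by
  have h2' : ε < betaNorm a b * (1 / 2) ^ (a + b) := by
    rcases le_total b a with h | h
    · exact h2 h
    · refine h1.trans_le (mul_le_mul_of_nonneg_left ?_ (betaNorm_pos _ _).le)
      have := pow_mul_pow_le_of_le hr hrq h
      rwa [hqr] at this
  refine lt_of_pow_lt_pow_left₀ 2 (by positivity) ?_
  calc ε ^ 2 = ε * ε := sq ε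
    _ < (betaNorm a b * (1 / 2) ^ (a + b)) * (betaNorm a b * (q ^ a * r ^ b)) :=
        mul_lt_mul'' h2' h1 hε.le hε.le
    _ = (a + b + 1) ^ 2 *
        (((a + b).choose a : ℝ) ^ 2 * ((1 / 2) ^ (a + b) * (q ^ a * r ^ b))) := by
        rw [betaNorm_eq_choose]; ring
    _ ≤ (a + b + 1) ^ 2 * Real.exp (-((a + b) * (q - r) ^ 2 / 4)) := by
        gcongr
        exact choose_sq_mul_le (hr.trans hrq) hr hqr a b
    _ = _ := by
        rw [mul_pow, ← Real.exp_nat_mul]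
        congr 2
        push_cast
        ring

/-- With `N` samples, where `2 N + 1` exceeds the bound `t₀`, the tail bound is beaten. -/
theorem mul_exp_le_of_le {u δ : ℝ} (hu : 1 ≤ u) (hδ0 : 0 < δ) (hδ1 : δ < 1) {N : ℝ}
    (hN : 194.07 * u ^ 2 * Real.log (Real.sqrt (2 * 79.86 / δ) * u) ≤ 2 * N + 1) :
    (N + 1) * Real.exp (-(N / (32 * u ^ 2))) ≤ δ / 2 := by
  set L := Real.log (Real.sqrt (2 * 79.86 / δ) * u) with hL
  have hs : 0 < Real.sqrt (2 * 79.86 / δ) := Real.sqrt_pos.2 (by positivity)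
  have hexp : Real.exp (2 * L) = 159.72 / δ * u ^ 2 := by
    rw [two_mul, Real.exp_add, hL, Real.exp_log (by positivity), mul_mul_mul_comm,
      Real.mul_self_sqrt (by positivity)]
    ring
  have hL2 : 2 ≤ L := by
    rw [hL, Real.le_log_iff_exp_le (by positivity)]
    have h1 : (8 : ℝ) ≤ Real.sqrt (2 * 79.86 / δ) := by
      apply Real.le_sqrt_of_sq_le
      rw [le_div_iff₀ hδ0]
      nlinarith
    have h2 : Real.exp 2 ≤ 8 := by
      have := Real.exp_one_lt_d9
      rw [show (2 : ℝ) = 1 + 1 by norm_num, Real.exp_add]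
      nlinarith [Real.exp_pos 1]
    nlinarith
  have hu2 : 1 ≤ u ^ 2 := one_le_pow₀ hu
  set y := N / (32 * u ^ 2) with hy
  have hNy : N = 32 * u ^ 2 * y := by rw [hy]; field_simp
  have huL : 2 ≤ u ^ 2 * L := by nlinarith
  -- Half of `194.07` exceeds `3 * 32` by `1.035`, and this surplus times `u ^ 2 * L ≥ 2` absorbs
  -- the `+ 1` of `hN`.
  have hyL : 3 * L ≤ y := by
    rw [hy, le_div_iff₀ (by positivity)]
    nlinarith
  have hN1 : N + 1 ≤ 33 * u ^ 2 * y := by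
    rw [hNy]
    nlinarith
  have h3 : y * Real.exp (-(y / 3)) ≤ 1.2 := by
    have h4 : y / 3 * Real.exp (-(y / 3)) ≤ Real.exp (-1) := by
      have := Real.add_one_le_exp (y / 3 - 1)
      rw [sub_add_cancel] at this
      calc y / 3 * Real.exp (-(y / 3)) ≤ Real.exp (y / 3 - 1) * Real.exp (-(y / 3)) := by gcongr
        _ = _ := by rw [← Real.exp_add]; congr 1; ring
    have := Real.exp_neg_one_lt_d9
    linarith
  have h5 : Real.exp (-(2 * y / 3)) ≤ δ / (159.72 * u ^ 2) := by
    calc Real.exp (-(2 * y / 3)) ≤ Real.exp (-(2 * L)) := by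
          apply Real.exp_le_exp.2
          linarith
      _ = _ := by
          rw [Real.exp_neg, hexp]
          field_simp
  -- One third of the exponent absorbs the linear factor `y`; the other two thirds yield `exp (-(2 *
  -- L))`, which `hexp` evaluates.
  calc (N + 1) * Real.exp (-y) ≤ 33 * u ^ 2 * y * Real.exp (-y) := by gcongr
    _ = 33 * u ^ 2 * ((y * Real.exp (-(y / 3))) * Real.exp (-(2 * y / 3))) := by
        rw [mul_assoc y, ← Real.exp_add, mul_assoc (33 * u ^ 2)]
        congr 4
        ring
    _ ≤ 33 * u ^ 2 * (1.2 * (δ / (159.72 * u ^ 2))) := by gcongr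
    _ ≤ δ / 2 := by
        rw [show 33 * u ^ 2 * (1.2 * (δ / (159.72 * u ^ 2))) = 33 * 1.2 / 159.72 * δ by
          field_simp]
        nlinarith

/-! ### Order statistics -/

theorem le_largest {α : Type*} [LinearOrder α] (v : Outcome → α) (o : Outcome) :
    v o ≤ largest v := by
  cases o <;> simp [largest]

theorem min_le_secondLargest {α : Type*} [LinearOrder α] (v : Outcome → α) {m o : Outcome}
    (h : o ≠ m) : min (v m) (v o) ≤ secondLargest v := by
  cases m <;> cases o <;> simp [secondLargest] at h ⊢

theorem largest_eq {α : Type*} [LinearOrder α] {v : Outcome → α} {m : Outcome}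
    (h : ∀ o, v o ≤ v m) : largest v = v m :=
  le_antisymm (max_le (h _) (max_le (h _) (h _))) (le_largest v m)

theorem secondLargest_eq {α : Type*} [LinearOrder α] {v : Outcome → α} {m o : Outcome}
    (hmo : o ≠ m) (ho : v o ≤ v m) (h : ∀ k, k ≠ m → v k ≤ v o) : secondLargest v = v o := by
  refine le_antisymm ?_ ((le_min ho le_rfl).trans (min_le_secondLargest v hmo))
  have h1 := h .win
  have h2 := h .indiff
  have h3 := h .loss
  cases m <;> cases o <;> simp [secondLargest] at h1 h2 h3 hmo ⊢ <;> grind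

theorem exists_forall_le {α : Type*} [LinearOrder α] (v : Outcome → α) :
    ∃ m, ∀ o, v o ≤ v m := by
  obtain ⟨m, -, hm⟩ := Finset.exists_max_image Finset.univ v ⟨.win, Finset.mem_univ _⟩
  exact ⟨m, fun o => hm o (Finset.mem_univ _)⟩

theorem exists_ne_forall_le {α : Type*} [LinearOrder α] (v : Outcome → α) (m : Outcome) :
    ∃ o, o ≠ m ∧ ∀ k, k ≠ m → v k ≤ v o := by
  obtain ⟨o, ho, h⟩ := Finset.exists_max_image (Finset.univ.erase m) v
    (by cases m; exacts [⟨.loss, by simp⟩, ⟨.loss, by simp⟩, ⟨.win, by simp⟩])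
  exact ⟨o, Finset.ne_of_mem_erase ho, fun k hk => h k (Finset.mem_erase.2 ⟨hk, Finset.mem_univ _⟩)⟩

theorem exists_mode {α : Type*} [LinearOrder α] {v : Outcome → α}
    (h : secondLargest v < largest v) : ∃ m, ∀ o, o ≠ m → v o < v m := by
  obtain ⟨m, hm⟩ := exists_forall_le v
  obtain ⟨o, ho, hk⟩ := exists_ne_forall_le v m
  rw [largest_eq hm, secondLargest_eq ho (hm o) hk] at h
  exact ⟨m, fun k hkm => (hk k hkm).trans_lt h⟩

/-! ### Analysis of PPR-1v1 -/

theorem pprTest_iff (δ : ℝ) (x : ℕ → Outcome) (t : ℕ) :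
    PPRTest δ x t ↔ betaNorm (largest (count x t)) (secondLargest (count x t)) *
      (1 / 2) ^ (largest (count x t) + secondLargest (count x t)) ≤ δ / 2 := by
  rw [← betaPDFReal_half]
  rfl

theorem not_pprTest_zero {δ : ℝ} (hδ1 : δ < 1) (x : ℕ → Outcome) : ¬ PPRTest δ x 0 := by
  rw [pprTest_iff]
  simp [largest, secondLargest, count_zero, betaNorm]
  linarith

/-- On a typical feedback sequence, PPR-1v1 does not return anything but the mode. -/
theorem eq_mode_of_pprTest {p : Outcome → ℝ} (hp : ∀ o, 0 ≤ p o) {m : Outcome}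
    (hm : ∀ o, o ≠ m → p o < p m) {δ : ℝ} {x : ℕ → Outcome}
    (hx : ∀ o, o ≠ m → Typical p (δ / 2) m o x) {t : ℕ} (ht : PPRTest δ x t) {k : Outcome}
    (hk : ∀ o, count x t o ≤ count x t k) : k = m := by
  by_contra hkm
  rw [pprTest_iff, largest_eq hk] at ht
  have hmk := min_le_secondLargest (count x t) (Ne.symm hkm)
  rw [min_eq_right (hk m)] at hmk
  have hsk : secondLargest (count x t) ≤ count x t k := by
    simp only [secondLargest, max_le_iff, min_le_iff, hk, or_true, and_self]
  -- `m` need not be the runner-up, but lowering the smaller count to that of `m` only lowers the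
  -- density at `1 / 2`.
  have h1 := (betaNorm_half_mono hmk hsk).trans ht
  rw [betaNorm_comm, add_comm (count x t k)] at h1
  have h2 := hx k hkm t
  have hs : 0 < p m + p k := add_pos_of_pos_of_nonneg ((hp k).trans_lt (hm k hkm)) (hp k)
  have h3 := pow_mul_pow_le_of_le (hp k) (hm k hkm).le (hk m)
  rw [div_pow, div_eq_mul_one_div, ← one_div_pow] at h3
  refine absurd h2 (not_lt.2 ?_)
  calc _ ≤ betaNorm (count x t m) (count x t k) *
        ((p m + p k) ^ (count x t m + count x t k) *
          (1 / 2) ^ (count x t m + count x t k)) :=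
        mul_le_mul_of_nonneg_left h3 (betaNorm_pos _ _).le
    _ = betaNorm (count x t m) (count x t k) * (1 / 2) ^ (count x t m + count x t k) *
        (p m + p k) ^ (count x t m + count x t k) := by ring
    _ ≤ _ := mul_le_mul_of_nonneg_right h1 (by positivity)

/-- On a typical feedback sequence, the stopping test of PPR-1v1 is passed at time `⌊t₀⌋`. -/
theorem pprTest_of_typical {p : Outcome → ℝ} (hp : ∀ o, 0 ≤ p o) (hp1 : ∀ o, p o ≤ 1)
    {m : Outcome} (hm : ∀ o, o ≠ m → p o < p m) {δ : ℝ} (hδ0 : 0 < δ) (hδ1 : δ < 1)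
    {x : ℕ → Outcome} (hx : ∀ o, o ≠ m → Typical p (δ / 2) m o x) {t : ℕ}
    (ht : t₀ p δ ≤ t + 1) : PPRTest δ x t := by
  by_contra hn
  obtain ⟨l, hl, hlmax⟩ := exists_ne_forall_le p m
  have hle : ∀ o, p o ≤ p m := fun o => by
    by_cases h : o = m
    · rw [h]
    · exact (hm o h).le
  unfold t₀ at ht
  rw [largest_eq hle, secondLargest_eq hl (hle l) hlmax] at ht
  have hpm : 0 < p m := (hp l).trans_lt (hm l hl)
  have hg : 0 < p m - p l := sub_pos.2 (hm l hl)
  set u := p m / (p m - p l) with hu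
  have hu1 : 1 ≤ u := by
    rw [hu, le_div_iff₀ hg]
    linarith [hp l]
  obtain ⟨o, ho, homax⟩ := exists_ne_forall_le (count x t) m
  set a := count x t m with ha
  set b := count x t o with hb
  -- `o` is the most frequent rival of `m`, so the third count is at most `b`.
  have hN : (t : ℝ) ≤ 2 * ((a : ℝ) + b) := by
    have h1 := sum_count x t
    have h2 := homax .win
    have h3 := homax .indiff
    have h4 := homax .loss
    rw [Outcome.sum_univ] at h1
    have : t ≤ 2 * (a + b) := by
      cases m <;> cases o <;> simp at ho h2 h3 h4 <;> omega
    exact_mod_cast this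
  have hs : 0 < p m + p o := add_pos_of_pos_of_nonneg hpm (hp o)
  have h1 : δ / 2 < betaNorm a b * ((p m / (p m + p o)) ^ a * (p o / (p m + p o)) ^ b) := by
    have := hx o ho t
    rw [div_pow, div_pow, div_mul_div_comm, ← pow_add, mul_div_assoc', lt_div_iff₀ (by positivity)]
    exact this
  -- Only when `b ≤ a` are `a` and `b` sure to be the two largest counts, the ones the failed test
  -- speaks about.
  have h2 : b ≤ a → δ / 2 < betaNorm a b * (1 / 2) ^ (a + b) := by
    intro hba
    rw [pprTest_iff, largest_eq (m := m) fun k => ?_, secondLargest_eq ho hba homax, not_le] at hn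
    · exact hn
    · by_cases h : k = m
      · rw [h]
      · exact (homax k h).trans hba
  have h3 := lt_mul_exp_of_not_rejected (q := p m / (p m + p o)) (r := p o / (p m + p o))
    (div_nonneg (hp o) hs.le) (div_le_div_of_nonneg_right (hle o) hs.le)
    (by rw [← add_div, div_self hs.ne']) (by positivity) h1 h2
  have hL : 0 ≤ Real.log (Real.sqrt (2 * 79.86 / δ) * u) := by
    apply Real.log_nonneg
    refine one_le_mul_of_one_le_of_one_le (Real.one_le_sqrt.2 ?_) hu1
    rw [le_div_iff₀ hδ0]
    linarith
  have h4 := mul_exp_le_of_le hu1 hδ0 hδ1 (N := (a : ℝ) + b) <| by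
    refine le_trans ?_ (ht.trans (by linarith))
    rw [mul_div_right_comm (194.07 * p m), mul_div_assoc 194.07]
    refine mul_le_mul_of_nonneg_right (mul_le_mul_of_nonneg_left ?_ (by norm_num)) hL
    rw [hu, div_pow]
    refine div_le_div_of_nonneg_right ?_ (by positivity)
    -- `p m ≤ 1` gives `u ^ 2 ≤ p m / (p m - p l) ^ 2`, the factor appearing in `t₀`.
    nlinarith [hp1 m]
  refine absurd (h3.trans_le (le_trans ?_ h4)) (lt_irrefl _)
  refine mul_le_mul_of_nonneg_left (Real.exp_le_exp.2 (neg_le_neg ?_)) (by positivity)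
  -- The observed rival `o` may differ from the likeliest rival `l`; `p o ≤ p l` and `p m + p o ≤ 2
  -- * p m` suffice.
  have h5 : 1 / (2 * u) ≤ p m / (p m + p o) - p o / (p m + p o) := by
    rw [← sub_div, hu, mul_div_assoc', one_div_div, div_le_div_iff₀ (by positivity) hs]
    nlinarith [hlmax o ho, hle o, hp o]
  have h6 : 1 / (32 * u ^ 2) ≤ (p m / (p m + p o) - p o / (p m + p o)) ^ 2 / 8 := by
    have h7 := pow_le_pow_left₀ (by positivity) h5 2
    calc 1 / (32 * u ^ 2) = (1 / (2 * u)) ^ 2 / 8 := by field_simp; norm_num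
      _ ≤ _ := by gcongr
  calc ((a : ℝ) + b) / (32 * u ^ 2) = (a + b) * (1 / (32 * u ^ 2)) := by ring
    _ ≤ (a + b) * ((p m / (p m + p o) - p o / (p m + p o)) ^ 2 / 8) := by gcongr
    _ = _ := by ring

/-- On a typical feedback sequence, PPR-1v1 returns the mode after at most `t₀` samples. -/
theorem exists_pprReturns {p : Outcome → ℝ} (hp : ∀ o, 0 ≤ p o) (hp1 : ∀ o, p o ≤ 1)
    {m : Outcome} (hm : ∀ o, o ≠ m → p o < p m) {δ : ℝ} (hδ0 : 0 < δ) (hδ1 : δ < 1)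
    {x : ℕ → Outcome} (hx : ∀ o, o ≠ m → Typical p (δ / 2) m o x) :
    ∃ t : ℕ, (t : ℝ) ≤ t₀ p δ ∧ PPRReturns δ x t m := by
  classical
  have htest : PPRTest δ x ⌊t₀ p δ⌋₊ :=
    pprTest_of_typical hp hp1 hm hδ0 hδ1 hx (Nat.lt_floor_add_one _).le
  have hex : ∃ t, PPRTest δ x t := ⟨_, htest⟩
  -- The uniform density `1` at time `0` exceeds `δ / 2`, so the first passage is a genuine stopping
  -- time `≥ 1`.
  have h0 : Nat.find hex ≠ 0 := fun h => not_pprTest_zero hδ1 x (h ▸ Nat.find_spec hex)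
  refine ⟨Nat.find hex, (Nat.le_floor_iff' h0).1 (Nat.find_min' hex htest),
    Nat.one_le_iff_ne_zero.2 h0, Nat.find_spec hex, fun u _ hu => Nat.find_min hex hu, ?_⟩
  obtain ⟨k, hk⟩ := exists_forall_le (count x (Nat.find hex))
  rwa [eq_mode_of_pprTest hp hm hx (Nat.find_spec hex) hk] at hk

/-! ### Exchanging the two arms of a duel -/

theorem Outcome.swap_swap (o : Outcome) : o.swap.swap = o := by
  cases o <;> rfl

theorem count_swap {x y : ℕ → Outcome} (h : ∀ t, y t = (x t).swap) (t : ℕ) (o : Outcome) :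
    count y t o = count x t o.swap := by
  unfold count
  congr 1
  refine Finset.filter_congr fun m _ => ?_
  rw [h]
  constructor
  · rintro rfl
    rw [Outcome.swap_swap]
  · intro h
    rw [h, Outcome.swap_swap]

/-- Typicality is established for pairs `i < j` only, while the loop may duel a pair in either
order. -/
theorem Typical.swap {p q : Outcome → ℝ} (hpq : ∀ o, q o = p o.swap) {ε : ℝ} {m o : Outcome}
    {x y : ℕ → Outcome} (hxy : ∀ t, y t = (x t).swap) (h : Typical p ε m.swap o.swap x) :
    Typical q ε m o y := by
  intro t
  rw [hpq, hpq, count_swap hxy, count_swap hxy]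
  exact h t

theorem t₀_swap {p q : Outcome → ℝ} (hpq : ∀ o, q o = p o.swap) (δ : ℝ) : t₀ q δ = t₀ p δ := by
  have h1 : largest q = largest p := by
    simp only [largest, hpq, Outcome.swap]
    ac_rfl
  have h2 : secondLargest q = secondLargest p := by
    simp only [secondLargest, hpq, Outcome.swap]
    ac_rfl
  simp only [t₀, h1, h2]

/-! ### Analysis of the main loop -/

/-- The contribution of a duel decided as `k` to the Copeland score of its first arm. -/
def Outcome.score : Outcome → ℚ
  | .win => 1
  | .indiff => 1 / 2
  | .loss => 0

theorem Outcome.score_nonneg (k : Outcome) : 0 ≤ k.score := by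
  cases k <;> norm_num [Outcome.score]

theorem Outcome.score_le_one (k : Outcome) : k.score ≤ 1 := by
  cases k <;> norm_num [Outcome.score]

namespace State

variable {n : ℕ}

/-- The variables of the state `s` record the results `M` of the duels held so far. -/
structure Consistent (M : Fin n → Fin n → Outcome) (s : State n) : Prop where
  self_mem : ∀ i, i ∈ s.D i
  symm : ∀ i j, j ∈ s.D i → i ∈ s.D j
  cur_eq : ∀ i, s.cur i = ∑ j ∈ (s.D i).erase i, (M i j).score

/-- The Copeland score that results if every duel is decided as in `M`. -/
def total (M : Fin n → Fin n → Outcome) (i : Fin n) : ℚ :=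
  ∑ j ∈ Finset.univ.erase i, (M i j).score

theorem consistent_init (M : Fin n → Fin n → Outcome) : (init n).Consistent M where
  self_mem i := by simp [init]
  symm i j h := by simp_all [init]
  cur_eq i := by simp [init]

variable {M : Fin n → Fin n → Outcome} {s : State n}

theorem Consistent.cur_le_total (hs : s.Consistent M) (i : Fin n) : s.cur i ≤ total M i := by
  rw [hs.cur_eq]
  exact Finset.sum_le_sum_of_subset_of_nonneg (Finset.erase_subset_erase _ (Finset.subset_univ _))
    fun _ _ _ => Outcome.score_nonneg _

/-- The potential score grants a full point for each arm not yet compared, the most a duel can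
yield. -/
theorem Consistent.total_le_pot (hs : s.Consistent M) (i : Fin n) : total M i ≤ s.pot i := by
  have h1 : (s.D i).erase i ⊆ Finset.univ.erase i :=
    Finset.erase_subset_erase _ (Finset.subset_univ _)
  have h2 : (Finset.univ.erase i) \ (s.D i).erase i = (s.D i)ᶜ := by
    ext j
    have := hs.self_mem i
    by_cases hj : j = i <;> simp_all
  have h3 : ∑ j ∈ (s.D i)ᶜ, (M i j).score ≤ ((s.D i)ᶜ.card : ℚ) := by
    simpa using Finset.sum_le_card_nsmul (s.D i)ᶜ (fun j => (M i j).score) 1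
      fun j _ => Outcome.score_le_one _
  have h4 : (((s.D i)ᶜ.card : ℕ) : ℚ) = n - (s.D i).card := by
    rw [Finset.card_compl, Fintype.card_fin, Nat.cast_sub]
    simpa using Finset.card_le_univ (s.D i)
  unfold total pot
  rw [← Finset.sum_sdiff h1, h2, ← hs.cur_eq, ← h4]
  linarith

theorem Consistent.total_le_of_stops (hs : s.Consistent M) {i : Fin n} (hi : s.Stops i)
    (j : Fin n) : total M j ≤ total M i := by
  by_cases hj : j = i
  · rw [hj]
  · exact (hs.total_le_pot j).trans ((hi j hj).trans (hs.cur_le_total i))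

/-- An arm of maximal potential score that is compared to all arms fulfils the termination
criterion. -/
theorem stops_of_forall_mem {i : Fin n} (hmax : ∀ j, s.pot j ≤ s.pot i)
    (hD : ∀ j, j ∈ s.D i) : s.Stops i := by
  intro j _
  refine (hmax j).trans (le_of_eq ?_)
  rw [pot, Finset.eq_univ_of_forall hD]
  simp

theorem mem_update {i j : Fin n} (k : Outcome) (a b : Fin n) :
    b ∈ (s.update i j k).D a ↔
      b ∈ s.D a ∨ (a = i ∧ b = j) ∨ (a = j ∧ b = i) := by
  simp only [update]
  split_ifs with h1 h2
  · subst h1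
    by_cases h : a = j
    · subst h
      simp [or_comm]
    · simp [h, or_comm]
  · subst h2
    simp [h1, or_comm]
  · simp [h1, h2]

theorem Consistent.update (hs : s.Consistent M) {i j : Fin n} (hij : i ≠ j) (hj : j ∉ s.D i)
    (hM : M j i = (M i j).swap) : (s.update i j (M i j)).Consistent M where
  self_mem a := (mem_update _ a a).2 (Or.inl (hs.self_mem a))
  symm a b h := by
    rw [mem_update _] at h ⊢
    rcases h with h | h | h
    · exact Or.inl (hs.symm _ _ h)
    · exact Or.inr (Or.inr h.symm)
    · exact Or.inr (Or.inl h.symm)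
  cur_eq a := by
    have hi : i ∉ s.D j := fun h => hj (hs.symm _ _ h)
    by_cases hai : a = i
    · subst hai
      simp only [State.update, if_true, true_or]
      rw [Finset.erase_insert_of_ne hij.symm, Finset.sum_insert (by simp [hj]), ← hs.cur_eq]
      cases M a j <;> simp [Outcome.score, hij, add_comm]
    · by_cases haj : a = j
      · subst haj
        simp only [State.update, if_true, if_neg hai, or_true]
        rw [Finset.erase_insert_of_ne hij, Finset.sum_insert (by simp [hi]), ← hs.cur_eq, hM]
        cases M i a <;> simp [Outcome.score, Outcome.swap, add_comm]
      · simp only [State.update, if_neg hai, if_neg haj]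
        rw [← hs.cur_eq]
        cases M i j <;> simp [hai, haj]

/-- The pairs of arms that are not yet compared. -/
def openPairs (s : State n) : Finset (Fin n × Fin n) :=
  Finset.univ.filter fun p => p.1 < p.2 ∧ p.2 ∉ s.D p.1

/-- A round closes exactly one pair, which gives both termination and the budget of one `T` per
pair. -/
theorem Consistent.openPairs_eq_insert (hs : s.Consistent M) {i j : Fin n} (k : Outcome)
    (hij : i ≠ j) (hj : j ∉ s.D i) :
    (min i j, max i j) ∉ (s.update i j k).openPairs ∧
      s.openPairs = insert (min i j, max i j) (s.update i j k).openPairs := by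
  have hi : i ∉ s.D j := fun h => hj (hs.symm _ _ h)
  simp only [openPairs]
  constructor
  · rcases hij.lt_or_gt with h | h <;>
      simp [mem_update _, h, h.le]
  · ext ⟨a, b⟩
    simp only [Finset.mem_insert, Finset.mem_filter, Finset.mem_univ, true_and,
      mem_update _, Prod.mk.injEq]
    rcases hij.lt_or_gt with h | h
    · rw [min_eq_left h.le, max_eq_right h.le]
      grind
    · rw [min_eq_right h.le, max_eq_left h.le]
      grind

theorem openPairs_init : (init n).openPairs = Finset.univ.filter fun p => p.1 < p.2 := by
  simp only [openPairs, init]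
  refine Finset.filter_congr fun p _ => ?_
  simp only [Finset.mem_singleton, and_iff_left_iff_imp]
  exact fun h => h.ne'

/-- If PPR-1v1 decides every duel of `i` and `j` as `M i j` within `T i j` samples, then the main
loop terminates after the sum of these budgets over the open pairs, and returns an arm of maximal
score. -/
theorem Consistent.exists_run (tb : TieBreak n) {δ' : ℝ} {x : Fin n → Fin n → ℕ → Outcome}
    {T : Fin n → Fin n → ℝ} (hM : ∀ i j, i ≠ j → M j i = (M i j).swap)
    (hT : ∀ i j, i ≠ j → T j i = T i j)
    (hx : ∀ i j, i ≠ j → ∃ t : ℕ, (t : ℝ) ≤ T i j ∧ PPRReturns δ' (x i j) t (M i j))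
    (hs : s.Consistent M) :
    ∃ (τ : ℕ) (r : Fin n), Run tb δ' x s τ r ∧ (∀ j, total M j ≤ total M r) ∧
      (τ : ℝ) ≤ ∑ p ∈ s.openPairs, T p.1 p.2 := by
  induction hc : s.openPairs.card using Nat.strong_induction_on generalizing s with
  | _ c ih =>
    by_cases hhalt : ∃ i, s.Stops i
    · refine ⟨0, tb.winner s, .halt s hhalt,
        hs.total_le_of_stops (tb.winner_stops s hhalt), ?_⟩
      rw [Nat.cast_zero]
      refine Finset.sum_nonneg fun p hp => ?_
      obtain ⟨t, ht, -⟩ := hx p.1 p.2 (Finset.mem_filter.1 hp).2.1.ne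
      exact (Nat.cast_nonneg t).trans ht
    · set i := tb.first s with hi
      set j := tb.second s i with hj
      have hjD : j ∉ s.D i := by
        refine tb.second_notMem s i ?_
        by_contra! h
        exact hhalt ⟨i, stops_of_forall_mem (tb.first_max s) h⟩
      have hij : i ≠ j := fun h => hjD (h ▸ hs.self_mem i)
      obtain ⟨hnot, hins⟩ := hs.openPairs_eq_insert (M i j) hij hjD
      obtain ⟨t, ht, hret⟩ := hx i j hij
      obtain ⟨τ, r, hrun, hr, hτ⟩ := ih _
        (by rw [← hc, hins, Finset.card_insert_of_notMem hnot]; exact Nat.lt_succ_self _)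
        (hs.update hij hjD (hM i j hij)) rfl
      refine ⟨t + τ, r, .round s hhalt i j hi hj t (M i j) hret τ r hrun, hr, ?_⟩
      rw [hins, Finset.sum_insert hnot, Nat.cast_add]
      refine add_le_add (ht.trans (le_of_eq ?_)) hτ
      rcases hij.lt_or_gt with h | h
      · simp [h.le]
      · simp [h.le, hT i j hij]

end State

/-! ### The random feedback -/

namespace Bandit

variable {n : ℕ} (P : Bandit n)

theorem prob_nonneg (i j : Fin n) (o : Outcome) : 0 ≤ P.prob i j o := by
  cases o
  · exact P.nonneg i j
  · have := P.add_le_one i j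
    simp only [prob]
    linarith
  · exact P.nonneg j i

theorem sum_prob (i j : Fin n) : ∑ o, P.prob i j o = 1 := by
  simp [Outcome.sum_univ, prob]

theorem prob_le_one (i j : Fin n) (o : Outcome) : P.prob i j o ≤ 1 := by
  rw [← P.sum_prob i j]
  exact Finset.single_le_sum (fun o _ => P.prob_nonneg i j o) (Finset.mem_univ o)

theorem prob_swap (i j : Fin n) (o : Outcome) : P.prob j i o = P.prob i j o.swap := by
  cases o <;> simp [prob, Outcome.swap]
  ring

theorem copelandScore_eq_total {M : Fin n → Fin n → Outcome}
    (hM : ∀ i j, i ≠ j → ∀ o, o ≠ M i j → P.prob i j o < P.prob i j (M i j)) (i : Fin n) :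
    P.copelandScore i = State.total M i := by
  unfold copelandScore State.total
  rw [Finset.mul_sum, ← Finset.sum_add_distrib]
  refine Finset.sum_congr rfl fun j hj => ?_
  have h := hM i j (Finset.ne_of_mem_erase hj).symm
  have h1 := h .win
  have h2 := h .indiff
  have h3 := h .loss
  generalize M i j = m at h1 h2 h3
  cases m <;> simp at h1 h2 h3 <;> simp only [gt_iff_lt, max_lt_iff, Outcome.score]
  · simp [h2, h3, h2.not_gt]
  · simp [h1, h3, h1.not_gt]
  · simp [h1.not_gt, h2.not_gt]

end Bandit

theorem IsFeedback.measure_cylinder {n : ℕ} {P : Bandit n} {Ω : Type*} [MeasurableSpace Ω]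
    {μ : Measure Ω} {X : Fin n → Fin n → ℕ → Ω → Outcome} (hX : IsFeedback P μ X)
    {i j : Fin n} (hij : i < j) (t : ℕ) (w : ℕ → Outcome) :
    μ {ω | ∀ m < t, X i j m ω = w m} =
      ENNReal.ofReal (∏ m ∈ Finset.range t, P.prob i j (w m)) := by
  have hind : iIndepFun (fun m => X i j m) μ :=
    hX.indep.precomp (g := fun m : ℕ => ((⟨(i, j), hij⟩ : {p : Fin n × Fin n // p.1 < p.2}), m))
      fun a b h => (Prod.mk.inj h).2
  have h := hind.measure_inter_preimage_eq_mul (Finset.range t) (sets := fun m => {w m})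
    fun m _ => trivial
  rw [ENNReal.ofReal_prod_of_nonneg fun m _ => P.prob_nonneg i j _,
    Finset.prod_congr rfl fun m _ => (hX.law i j m (w m) hij.ne).symm]
  have hset : {ω | ∀ m < t, X i j m ω = w m} = ⋂ m ∈ Finset.range t, X i j m ⁻¹' {w m} := by
    ext ω
    simp
  rw [hset]
  exact h

theorem IsFeedback.measure_exists_not_typical_le {n : ℕ} {P : Bandit n} {Ω : Type*}
    [MeasurableSpace Ω] {μ : Measure Ω} {X : Fin n → Fin n → ℕ → Ω → Outcome}
    (hX : IsFeedback P μ X) {i j : Fin n} (hij : i < j) {δ : ℝ} (hδ : 0 ≤ δ) (m : Outcome) :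
    μ {ω | ∃ o, o ≠ m ∧ ¬ Typical (P.prob i j) (δ / 2) m o (fun t => X i j t ω)} ≤
      ENNReal.ofReal δ := by
  have h1 : {ω | ∃ o, o ≠ m ∧ ¬ Typical (P.prob i j) (δ / 2) m o (fun t => X i j t ω)} =
      ⋃ o ∈ Finset.univ.erase m,
        {ω | ¬ Typical (P.prob i j) (δ / 2) m o (fun t => X i j t ω)} := by
    ext ω
    simp
  have h2 : (Finset.univ.erase m : Finset Outcome).card = 2 := by
    rw [Finset.card_erase_of_mem (Finset.mem_univ _)]
    rfl
  rw [h1]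
  refine (measure_biUnion_finset_le _ _).trans ?_
  refine (Finset.sum_le_card_nsmul _ _ (ENNReal.ofReal (δ / 2)) fun o ho =>
    measure_not_typical_le μ (X i j) _ (P.prob_nonneg i j) (P.sum_prob i j)
      (hX.measure_cylinder hij) (by positivity) (Finset.ne_of_mem_erase ho)).trans ?_
  rw [h2, ← ENNReal.ofReal_nsmul]
  exact ENNReal.ofReal_le_ofReal (by simp [mul_div_cancel₀])

end Pocowista

theorem theorem3p1 {n : ℕ} (hn : 2 ≤ n) (P : Bandit n)
    (hP : ∀ i j : Fin n, i ≠ j → secondLargest (P.prob i j) < largest (P.prob i j))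
    (δ : ℝ) (hδ0 : 0 < δ) (hδ1 : δ < 1)
    {Ω : Type*} [MeasurableSpace Ω] (μ : Measure Ω)
    [IsProbabilityMeasure μ]
    (X : Fin n → Fin n → ℕ → Ω → Outcome) (hX : IsFeedback P μ X)
    (tb : Ω → TieBreak n) :
    ENNReal.ofReal (1 - δ) ≤
      μ {ω | ∃ (τ : ℕ) (r : Fin n),
        Returns (tb ω) δ (fun i j m => X i j m ω) τ r ∧ r ∈ P.copelandSet ∧
        (τ : ℝ) ≤ ∑ i : Fin n, ∑ j ∈ Finset.Ioi i, t₀ (P.prob i j) (δ / (n.choose 2 : ℝ))} := by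
  have hc : (1 : ℝ) ≤ (n.choose 2 : ℝ) := by exact_mod_cast Nat.choose_pos hn
  set δ' := δ / (n.choose 2 : ℝ) with hδ'
  have hδ'0 : 0 < δ' := by positivity
  have hδ'1 : δ' < 1 := (div_le_self hδ0.le hc).trans_lt hδ1
  -- Supplies the value of `M` on the diagonal, which is never used.
  have : Nonempty Outcome := ⟨.win⟩
  choose! M hM using fun i j hij => exists_mode (hP i j hij)
  have hMswap : ∀ i j, i ≠ j → M j i = (M i j).swap := by
    intro i j hij
    by_contra hne
    have h1 := hM j i hij.symm _ (Ne.symm hne)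
    rw [P.prob_swap i j, P.prob_swap i j, Outcome.swap_swap] at h1
    refine absurd h1 (hM i j hij _ fun h => hne ?_).not_gt
    rw [← h, Outcome.swap_swap]
  set pairs : Finset (Fin n × Fin n) := Finset.univ.filter fun p => p.1 < p.2 with hpairs
  set good := {ω | ∃ (τ : ℕ) (r : Fin n),
    Returns (tb ω) δ (fun i j m => X i j m ω) τ r ∧ r ∈ P.copelandSet ∧
    (τ : ℝ) ≤ ∑ i : Fin n, ∑ j ∈ Finset.Ioi i, t₀ (P.prob i j) δ'} with hgood
  set bad := ⋃ p ∈ pairs, {ω | ∃ o, o ≠ M p.1 p.2 ∧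
    ¬ Typical (P.prob p.1 p.2) (δ' / 2) (M p.1 p.2) o (fun t => X p.1 p.2 t ω)} with hbad
  have hbadle : μ bad ≤ ENNReal.ofReal δ := by
    refine (measure_biUnion_finset_le _ _).trans ?_
    refine (Finset.sum_le_card_nsmul _ _ (ENNReal.ofReal δ') fun p hp =>
      hX.measure_exists_not_typical_le (Finset.mem_filter.1 hp).2 hδ'0.le _).trans ?_
    rw [Fintype.card_product_filter_lt, Fintype.card_fin, ← ENNReal.ofReal_nsmul]
    refine ENNReal.ofReal_le_ofReal (le_of_eq ?_)
    rw [nsmul_eq_mul, hδ']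
    field_simp
  have hcover : ∀ ω, ω ∉ bad → ω ∈ good := by
    intro ω hω
    simp only [hbad, hpairs, Set.mem_iUnion, Finset.mem_filter, Finset.mem_univ, true_and,
      Set.mem_ofPred_eq, not_exists, not_and, not_not, Prod.forall] at hω
    have htyp : ∀ i j, i ≠ j → ∀ o, o ≠ M i j →
        Typical (P.prob i j) (δ' / 2) (M i j) o (fun t => X i j t ω) := by
      intro i j hij o ho
      rcases hij.lt_or_gt with h | h
      · exact hω i j h o ho
      · refine Typical.swap (P.prob_swap j i) (fun t => hX.swap j i t ω hij.symm) ?_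
        rw [← hMswap i j hij]
        refine hω j i h _ fun h' => ho ?_
        rw [hMswap i j hij] at h'
        rw [← Outcome.swap_swap o, h', Outcome.swap_swap]
    obtain ⟨τ, r, hrun, hr, hτ⟩ := (State.consistent_init M).exists_run (tb ω)
      (x := fun i j m => X i j m ω) (T := fun i j => t₀ (P.prob i j) δ') hMswap
      (fun i j _ => t₀_swap (P.prob_swap i j) δ')
      (fun i j hij => exists_pprReturns (P.prob_nonneg i j) (P.prob_le_one i j) (hM i j hij)
        hδ'0 hδ'1 (htyp i j hij))
    refine ⟨τ, r, hrun, fun j => ?_, hτ.trans (le_of_eq ?_)⟩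
    · rw [P.copelandScore_eq_total hM, P.copelandScore_eq_total hM]
      exact hr j
    · rw [State.openPairs_init, Finset.sum_filter, Fintype.sum_prod_type]
      refine Finset.sum_congr rfl fun i _ => ?_
      rw [← Finset.sum_filter]
      refine Finset.sum_congr ?_ fun _ _ => rfl
      ext j
      simp
  -- Subadditivity instead of complements: `tb` is an arbitrary function of `ω`, so `good` need not
  -- be measurable.
  have hone : (1 : ENNReal) ≤ μ good + μ bad := by
    rw [← measure_univ (μ := μ)]
    refine (measure_mono fun ω _ => ?_).trans (measure_union_le good bad)
    by_cases h : ω ∈ bad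
    · exact Or.inr h
    · exact Or.inl (hcover ω h)
  rw [ENNReal.ofReal_sub _ hδ0.le, ENNReal.ofReal_one]
  exact tsub_le_iff_right.2 (hone.trans (by gcongr))
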